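/- All manifolds are smooth, finite-dimensional and without boundary, and all Riemannian metrics are smooth. For a smooth map $\phi:(M,g)\to(N,h)$ between Riemannian manifolds let $\nabla^{\phi}$ be the connection on the pull-back bundle $\phi^{-1}TN$ induced by the Levi-Civita connection of $h$. The tension field of $\phi$ is $\tau(\phi)=\operatorname{trace}_g\nabla d\phi$, and its bitension field is $$\tau_2(\phi)=-J(\tau(\phi)),\qquad J(V)=\Delta^{\phi}V+\operatorname{trace}_g R^N(d\phi\,\cdot,V)\,d\phi\,\cdot,\qquad \Delta^{\phi}=-\operatorname{trace}_g(\nabla^{\phi})^2,$$ where $R^N(X,Y)=[\nabla^N_X,\nabla^N_Y]-\nabla^N_{[X,Y]}$ is the curvature of $h$. The map $\phi$ is harmonic if $\tau(\phi)=0$. Let $\pi:(M,g)\to(N,h)$ be a Riemannian submersion (a smooth map such that each $d\pi_p$ is surjective and maps the orthogonal complement of $\ker d\pi_p$ isometrically to $T_{\pi(p)}N$) that is harmonic, and let $\widetilde h$ be any Riemannian metric on $N$. Denote by $\mathbf 1:(N,h)\to(N,\widetilde h)$ the identity map and put $\widetilde\pi=\mathbf 1\circ\pi:(M,g)\to(N,\widetilde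 h)$. Then, as sections along $\pi$, $$\tau(\widetilde\pi)=\tau(\mathbf 1)\circ\pi\qquad\text{and}\qquad \tau_2(\widetilde\pi)=\tau_2(\mathbf 1)\circ\pi .$$ -/

import Mathlib

open Bundle Module
open scoped Manifold ContDiff

noncomputable section

namespace Biharmonic

variable {E : Type*} [NormedAddCommGroup E] [NormedSpace ℝ E] [FiniteDimensional ℝ E]
  {M : Type*} [TopologicalSpace M] [ChartedSpace E M] [IsManifold 𝓘(ℝ, E) ∞ M]
  {F : Type*} [NormedAddCommGroup F] [NormedSpace ℝ F] [FiniteDimensional ℝ F]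
  {N : Type*} [TopologicalSpace N] [ChartedSpace F N] [IsManifold 𝓘(ℝ, F) ∞ N]

/-- The tangent space at a point of a manifold `M` (without boundary) modelled on `E`. -/
abbrev T (E : Type*) [NormedAddCommGroup E] [NormedSpace ℝ E]
    {M : Type*} [TopologicalSpace M] [ChartedSpace E M] (x : M) : Type _ :=
  TangentSpace 𝓘(ℝ, E) x

/-- Smooth Riemannian metrics on `M`. -/
abbrev Metric (E : Type*) [NormedAddCommGroup E] [NormedSpace ℝ E]
    (M : Type*) [TopologicalSpace M] [ChartedSpace E M] [IsManifold 𝓘(ℝ, E) ∞ M] : Type _ :=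
  ContMDiffRiemannianMetric 𝓘(ℝ, E) ∞ E (fun x : M ↦ TangentSpace 𝓘(ℝ, E) x)

/-- Every tangent space has an orthonormal basis. -/
theorem exists_orthonormal_basis (g : Metric E M) (x : M) :
    ∃ e : Basis (Fin (finrank ℝ E)) ℝ (T E x),
      ∀ i j, g.inner x (e i) (e j) = if i = j then 1 else 0 := by
  let _ : RiemannianBundle (fun x : M ↦ TangentSpace 𝓘(ℝ, E) x) := ⟨g.toRiemannianMetric⟩
  have : FiniteDimensional ℝ (TangentSpace 𝓘(ℝ, E) x) :=
    inferInstanceAs (FiniteDimensional ℝ E)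
  have hn : finrank ℝ (TangentSpace 𝓘(ℝ, E) x) = finrank ℝ E := rfl
  let b := (stdOrthonormalBasis ℝ (TangentSpace 𝓘(ℝ, E) x)).reindex (finCongr hn)
  refine ⟨b.toBasis, fun i j ↦ ?_⟩
  have h := orthonormal_iff_ite.mp b.orthonormal i j
  simp only [OrthonormalBasis.coe_toBasis]
  exact h

/-- An orthonormal basis of `T_x M` with respect to the metric `g`. -/
def onb (g : Metric E M) (x : M) : Basis (Fin (finrank ℝ E)) ℝ (T E x) :=
  (exists_orthonormal_basis g x).choose

/-- The trace `∑ᵢ B(eᵢ, eᵢ)` over a `g`-orthonormal basis of `T_x M`. -/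
def traceAt (g : Metric E M) (x : M) {V : Type*} [AddCommGroup V] (B : T E x → T E x → V) : V :=
  ∑ i, B (onb g x i) (onb g x i)

/-- The local vector field that extends `v ∈ T_x M` with constant coefficients in the coordinates
of the preferred chart at `x`. -/
abbrev ext {x : M} (v : T E x) : (y : M) → T E y :=
  FiberBundle.extend E v

/-- `Γ(u, v) = ∑ uⁱ vʲ Γᵏᵢⱼ ∂ₖ` at `x`, where the `Γᵏᵢⱼ` are the Christoffel symbols of `g` in the
preferred chart at `x`. It is the vector determined by
`2 g(Γ(u, v), w) = ∂ᵤ g(v, w) + ∂ᵥ g(u, w) - ∂_w g(u, v)`,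
where `u`, `v`, `w` are extended with constant coefficients. -/
def christoffel (g : Metric E M) (x : M) (u v : T E x) : T E x :=
  ∑ k, ((1 / 2 : ℝ) *
    (mvfderiv 𝓘(ℝ, E) (fun y ↦ g.inner y (ext v y) (ext (onb g x k) y)) x u
      + mvfderiv 𝓘(ℝ, E) (fun y ↦ g.inner y (ext u y) (ext (onb g x k) y)) x v
      - mvfderiv 𝓘(ℝ, E) (fun y ↦ g.inner y (ext u y) (ext v y)) x (onb g x k))) • onb g x k

/-- The covariant derivative `∇^φ_u V` at `p` of a section `V` of the pull-back bundle `φ⁻¹TN`, for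
the connection induced by the Levi-Civita connection of `h`: in coordinates at `φ p`,
`(∇^φ_u V)ᵏ = u(Vᵏ) + Γᵏᵢⱼ (dφ u)ⁱ Vʲ`. -/
def pullbackCov (h : Metric F N) (φ : M → N) (V : (p : M) → T F (φ p)) (p : M) (u : T E p) :
    T F (φ p) :=
  (trivializationAt F (fun y : N ↦ TangentSpace 𝓘(ℝ, F) y) (φ p)).symm (φ p)
      (mvfderiv 𝓘(ℝ, E) (fun p' ↦ (trivializationAt F (fun y : N ↦ TangentSpace 𝓘(ℝ, F) y) (φ p)
        ⟨φ p', V p'⟩).2) p u)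
    + christoffel h (φ p) (mfderiv 𝓘(ℝ, E) 𝓘(ℝ, F) φ p u) (V p)

/-- The Levi-Civita connection of `g`: `leviCivita g Y x u` is `(∇_u Y)(x)`. -/
def leviCivita (g : Metric E M) (Y : (x : M) → T E x) (x : M) (u : T E x) : T E x :=
  pullbackCov g id Y x u

/-- The curvature `R(u, v)w = ∇_u ∇_v w - ∇_v ∇_u w - ∇_{[u, v]} w` of `g` at `x`. -/
def curvature (g : Metric E M) (x : M) (u v w : T E x) : T E x :=
  leviCivita g (fun y ↦ leviCivita g (ext w) y (ext v y)) x u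
    - leviCivita g (fun y ↦ leviCivita g (ext w) y (ext u y)) x v
    - leviCivita g (ext w) x (VectorField.mlieBracket 𝓘(ℝ, E) (ext u) (ext v) x)

/-- The second fundamental form `∇dφ(u, v) = ∇^φ_u (dφ v) - dφ(∇_u v)` of `φ : (M, g) → (N, h)`. -/
def secondFundamentalForm (g : Metric E M) (h : Metric F N) (φ : M → N) (p : M) (u v : T E p) :
    T F (φ p) :=
  pullbackCov h φ (fun p' ↦ mfderiv 𝓘(ℝ, E) 𝓘(ℝ, F) φ p' (ext v p')) p u
    - mfderiv 𝓘(ℝ, E) 𝓘(ℝ, F) φ p (leviCivita g (ext v) p u)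

/-- The tension field `τ(φ) = trace_g ∇dφ` of `φ : (M, g) → (N, h)`. -/
def tension (g : Metric E M) (h : Metric F N) (φ : M → N) (p : M) : T F (φ p) :=
  traceAt g p (secondFundamentalForm g h φ p)

/-- The Laplacian `Δ^φ V = -trace_g (∇^φ)² V` on sections of `φ⁻¹TN`, where
`(∇^φ)²_{u, v} V = ∇^φ_u ∇^φ_v V - ∇^φ_{∇_u v} V`. -/
def laplacian (g : Metric E M) (h : Metric F N) (φ : M → N) (V : (p : M) → T F (φ p)) (p : M) :
    T F (φ p) :=
  -traceAt g p fun u v ↦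
    pullbackCov h φ (fun p' ↦ pullbackCov h φ V p' (ext v p')) p u
      - pullbackCov h φ V p (leviCivita g (ext v) p u)

/-- The Jacobi operator `J(V) = Δ^φ V + trace_g R^N(dφ ·, V) dφ ·` of `φ : (M, g) → (N, h)`. -/
def jacobi (g : Metric E M) (h : Metric F N) (φ : M → N) (V : (p : M) → T F (φ p)) (p : M) :
    T F (φ p) :=
  laplacian g h φ V p
    + traceAt g p fun u v ↦ curvature h (φ p) (mfderiv 𝓘(ℝ, E) 𝓘(ℝ, F) φ p u) (V p)
        (mfderiv 𝓘(ℝ, E) 𝓘(ℝ, F) φ p v)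

/-- The bitension field `τ₂(φ) = -J(τ(φ))` of `φ : (M, g) → (N, h)`. -/
def bitension (g : Metric E M) (h : Metric F N) (φ : M → N) (p : M) : T F (φ p) :=
  -jacobi g h φ (tension g h φ) p

/-- `φ : (M, g) → (N, h)` is harmonic: it is smooth and its tension field vanishes. -/
structure IsHarmonic (g : Metric E M) (h : Metric F N) (φ : M → N) : Prop where
  smooth : ContMDiff 𝓘(ℝ, E) 𝓘(ℝ, F) ∞ φ
  tension_eq_zero : ∀ p, tension g h φ p = 0

/-- `v ∈ T_p M` is horizontal: it is `g`-orthogonal to the kernel of `dpr`. -/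
def IsHorizontal (g : Metric E M) (pr : M → N) (p : M) (v : T E p) : Prop :=
  ∀ w : T E p, mfderiv 𝓘(ℝ, E) 𝓘(ℝ, F) pr p w = 0 → g.inner p v w = 0

/-- `pr : (M, g) → (N, h)` is a Riemannian submersion: it is smooth, each differential is surjective,
and each differential is isometric on horizontal vectors. -/
structure IsRiemannianSubmersion (g : Metric E M) (h : Metric F N) (pr : M → N) : Prop where
  smooth : ContMDiff 𝓘(ℝ, E) 𝓘(ℝ, F) ∞ pr
  surjective : ∀ p, Function.Surjective (mfderiv 𝓘(ℝ, E) 𝓘(ℝ, F) pr p)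
  isometric : ∀ (p : M) (u v : T E p),
    IsHorizontal (F := F) g pr p u → IsHorizontal (F := F) g pr p v →
    h.inner (pr p) (mfderiv 𝓘(ℝ, E) 𝓘(ℝ, F) pr p u) (mfderiv 𝓘(ℝ, E) 𝓘(ℝ, F) pr p v)
      = g.inner p u v

end Biharmonic

end

open Bundle Module
open scoped Manifold ContDiff Topology

noncomputable section

namespace Biharmonic

set_option linter.unusedSectionVars false

variable {E : Type*} [NormedAddCommGroup E] [NormedSpace ℝ E] [FiniteDimensional ℝ E]
  {M : Type*} [TopologicalSpace M] [ChartedSpace E M] [IsManifold 𝓘(ℝ, E) ∞ M]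
  {F : Type*} [NormedAddCommGroup F] [NormedSpace ℝ F] [FiniteDimensional ℝ F]
  {N : Type*} [TopologicalSpace N] [ChartedSpace F N] [IsManifold 𝓘(ℝ, F) ∞ N]

/-! Replacing the target metric h by h' changes the Levi-Civita connection of N by a tensor D = ∇' -
∇, so the tension field of any φ changes by trace_g D(dφ, dφ) (`tension_sub_tension`). For a
Riemannian submersion dπ dπ* = 1, hence trace_g B(dπ, dπ) = trace_h B for every bilinear B on the
tangent space of N (`IsRiemannianSubmersion.sum_comp`). Since π is harmonic for h, its tension for
h' is trace_h D = W ∘ π, where W is the tension field of the identity.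

The bitension needs one general formula. If τ(φ) = W ∘ φ for a smooth vector field W on N, the chain
rule gives trace (∇^φ)²(W ∘ φ) = trace_g ∇²W(dφ, dφ) + ∇_τ(φ) W, so τ₂(φ) = trace_g (∇²W - R(·,
W)·)(dφ, dφ) + ∇_W W (`bitension_of_tension_eq_comp`). It applies with the same W to the submersion
and to the identity, and the trace identity matches the two results.

Most of the length is regularity. The connection is defined pointwise, in the preferred chart at
each point and with an orthonormal basis picked by choice, so smooth dependence on the point is not
visible. The Koszul formula (`koszul`) and smooth orthonormal frames (`exists_orthonormal_frame`)
describe it without these choices; they yield smoothness of ∇_X Y and of W, as the second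
derivatives require. -/

/-- The coordinates of a section `V` of `φ⁻¹TN` in the preferred trivialization at `φ p`. -/
def coord (φ : M → N) (V : (p : M) → T F (φ p)) (p x : M) : F :=
  (trivializationAt F (fun y : N ↦ TangentSpace 𝓘(ℝ, F) y) (φ p) ⟨φ x, V x⟩).2

/-- Differentiability at `p` of a section of `φ⁻¹TN`, read in coordinates. -/
abbrev DiffAlong (E : Type*) [NormedAddCommGroup E] [NormedSpace ℝ E]
    {M : Type*} [TopologicalSpace M] [ChartedSpace E M]
    (φ : M → N) (V : (p : M) → T F (φ p)) (p : M) : Prop :=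
  MDifferentiableAt 𝓘(ℝ, E) 𝓘(ℝ, F) (coord φ V p) p

/-! ### Constant-coefficient extensions and derivatives of the metric -/

theorem mvfderiv_congr {f f' : M → F} {p : M} (h : f =ᶠ[𝓝 p] f') :
    mvfderiv 𝓘(ℝ, E) f p = mvfderiv 𝓘(ℝ, E) f' p := by
  ext v
  exact congr($(h.mfderiv_eq (I := 𝓘(ℝ, E)) (I' := 𝓘(ℝ, F))) v)

theorem eventually_ext_add {x : M} (v w : T E x) :
    ∀ᶠ y in 𝓝 x, ext (v + w) y = ext v y + ext w y := by
  set t := trivializationAt E (fun x : M ↦ TangentSpace 𝓘(ℝ, E) x) x with ht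
  have hx : x ∈ t.baseSet := FiberBundle.mem_baseSet_trivializationAt' x
  filter_upwards [t.open_baseSet.mem_nhds hx] with y hy
  have h1 : (t ⟨x, v + w⟩).2 = (t ⟨x, v⟩).2 + (t ⟨x, w⟩).2 := (t.linear ℝ hx).map_add v w
  simp only [FiberBundle.extend, ← ht, h1, ← Trivialization.symmL_apply (R := ℝ) t hy]
  exact (t.symmL ℝ y).map_add _ _

theorem eventually_ext_smul {x : M} (c : ℝ) (v : T E x) :
    ∀ᶠ y in 𝓝 x, ext (c • v) y = c • ext v y := by
  set t := trivializationAt E (fun x : M ↦ TangentSpace 𝓘(ℝ, E) x) x with ht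
  have hx : x ∈ t.baseSet := FiberBundle.mem_baseSet_trivializationAt' x
  filter_upwards [t.open_baseSet.mem_nhds hx] with y hy
  have h1 : (t ⟨x, c • v⟩).2 = c • (t ⟨x, v⟩).2 := (t.linear ℝ hx).map_smul c v
  simp only [FiberBundle.extend, ← ht, h1, ← Trivialization.symmL_apply (R := ℝ) t hy]
  exact (t.symmL ℝ y).map_smul _ _

theorem ext_self {x : M} (v : T E x) : ext v x = v :=
  FiberBundle.extend_apply_self E v

theorem contMDiffAt_ext {x : M} (v : T E x) :
    ContMDiffAt 𝓘(ℝ, E) (𝓘(ℝ, E).prod 𝓘(ℝ, E)) ∞ (fun y ↦ TotalSpace.mk' E y (ext v y)) x :=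
  FiberBundle.contMDiffAt_extend ..

theorem mdifferentiableAt_ext {x : M} (v : T E x) :
    MDifferentiableAt 𝓘(ℝ, E) (𝓘(ℝ, E).prod 𝓘(ℝ, E)) (fun y ↦ TotalSpace.mk' E y (ext v y)) x :=
  (contMDiffAt_ext v).mdifferentiableAt (by simp)

/-- The inner product of two `C^n` sections is `C^n`. -/
theorem contMDiffAt_inner (g : Metric E M) {X Y : (x : M) → T E x} {x : M}
    (hX : ContMDiffAt 𝓘(ℝ, E) (𝓘(ℝ, E).prod 𝓘(ℝ, E)) ∞ (fun y ↦ TotalSpace.mk' E y (X y)) x)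
    (hY : ContMDiffAt 𝓘(ℝ, E) (𝓘(ℝ, E).prod 𝓘(ℝ, E)) ∞ (fun y ↦ TotalSpace.mk' E y (Y y)) x) :
    ContMDiffAt 𝓘(ℝ, E) 𝓘(ℝ) ∞ (fun y ↦ g.inner y (X y) (Y y)) x := by
  have h : ContMDiffAt 𝓘(ℝ, E) (𝓘(ℝ, E).prod 𝓘(ℝ)) ∞
      (fun y ↦ TotalSpace.mk' ℝ (E := Bundle.Trivial M ℝ) y (g.inner y (X y) (Y y))) x :=
    ContMDiffAt.clm_bundle_apply₂ (F₁ := E) (F₂ := E) g.contMDiff.contMDiffAt hX hY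
  exact (contMDiffAt_totalSpace.1 h).2

theorem mdifferentiableAt_inner (g : Metric E M) {X Y : (x : M) → T E x} {x : M}
    (hX : MDifferentiableAt 𝓘(ℝ, E) (𝓘(ℝ, E).prod 𝓘(ℝ, E)) (fun y ↦ TotalSpace.mk' E y (X y)) x)
    (hY : MDifferentiableAt 𝓘(ℝ, E) (𝓘(ℝ, E).prod 𝓘(ℝ, E)) (fun y ↦ TotalSpace.mk' E y (Y y)) x) :
    MDifferentiableAt 𝓘(ℝ, E) 𝓘(ℝ) (fun y ↦ g.inner y (X y) (Y y)) x := by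
  have h : MDifferentiableAt 𝓘(ℝ, E) (𝓘(ℝ, E).prod 𝓘(ℝ))
      (fun y ↦ TotalSpace.mk' ℝ (E := Bundle.Trivial M ℝ) y (g.inner y (X y) (Y y))) x :=
    MDifferentiableAt.clm_bundle_apply₂ (F₁ := E) (F₂ := E)
      (g.contMDiff.mdifferentiableAt (by simp)) hX hY
  exact ((mdifferentiableAt_totalSpace _ _).1 h).2

/-- `∂_u g(v, w)` at `x`, where `v` and `w` are extended with constant coefficients. -/
def dInner (g : Metric E M) (x : M) (u v w : T E x) : ℝ :=
  mvfderiv 𝓘(ℝ, E) (fun y ↦ g.inner y (ext v y) (ext w y)) x u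

theorem mdifferentiableAt_inner_ext (g : Metric E M) {x : M} (v w : T E x) :
    MDifferentiableAt 𝓘(ℝ, E) 𝓘(ℝ) (fun y ↦ g.inner y (ext v y) (ext w y)) x :=
  mdifferentiableAt_inner g (mdifferentiableAt_ext v) (mdifferentiableAt_ext w)

theorem dInner_add₁ (g : Metric E M) (x : M) (u u' v w : T E x) :
    dInner g x (u + u') v w = dInner g x u v w + dInner g x u' v w := map_add _ _ _

theorem dInner_smul₁ (g : Metric E M) (x : M) (c : ℝ) (u v w : T E x) :
    dInner g x (c • u) v w = c * dInner g x u v w := map_smul _ _ _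

theorem dInner_comm (g : Metric E M) (x : M) (u v w : T E x) :
    dInner g x u v w = dInner g x u w v := by
  simp only [dInner, g.symm _ (ext v _)]

theorem dInner_add₂ (g : Metric E M) (x : M) (u v v' w : T E x) :
    dInner g x u (v + v') w = dInner g x u v w + dInner g x u v' w := by
  have h : (fun y ↦ g.inner y (ext (v + v') y) (ext w y)) =ᶠ[𝓝 x]
      fun y ↦ g.inner y (ext v y) (ext w y) + g.inner y (ext v' y) (ext w y) := by
    filter_upwards [eventually_ext_add v v'] with y hy
    rw [hy, map_add, add_apply]
  simp only [dInner]
  rw [mvfderiv_congr h, mvfderiv_fun_add (mdifferentiableAt_inner_ext g v w)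
    (mdifferentiableAt_inner_ext g v' w), add_apply]

theorem dInner_smul₂ (g : Metric E M) (x : M) (c : ℝ) (u v w : T E x) :
    dInner g x u (c • v) w = c * dInner g x u v w := by
  have h : (fun y ↦ g.inner y (ext (c • v) y) (ext w y)) =ᶠ[𝓝 x]
      fun y ↦ c * g.inner y (ext v y) (ext w y) := by
    filter_upwards [eventually_ext_smul c v] with y hy
    rw [hy, map_smul, smul_apply, smul_eq_mul]
  simp only [dInner]
  rw [mvfderiv_congr h, mvfderiv_fun_mul mdifferentiableAt_const
    (mdifferentiableAt_inner_ext g v w)]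
  simp [mvfderiv_const]

theorem dInner_add₃ (g : Metric E M) (x : M) (u v w w' : T E x) :
    dInner g x u v (w + w') = dInner g x u v w + dInner g x u v w' := by
  simp only [dInner_comm g x u v, dInner_add₂]

theorem dInner_smul₃ (g : Metric E M) (x : M) (c : ℝ) (u v w : T E x) :
    dInner g x u v (c • w) = c * dInner g x u v w := by
  simp only [dInner_comm g x u v, dInner_smul₂]

/-! ### Christoffel symbols -/

theorem onb_inner (g : Metric E M) (x : M) (i j : Fin (finrank ℝ E)) :
    g.inner x (onb g x i) (onb g x j) = if i = j then 1 else 0 :=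
  (exists_orthonormal_basis g x).choose_spec i j

theorem christoffel_eq (g : Metric E M) (x : M) (u v : T E x) :
    christoffel g x u v = ∑ k, ((1 / 2 : ℝ) * (dInner g x u v (onb g x k)
      + dInner g x v u (onb g x k) - dInner g x (onb g x k) u v)) • onb g x k := rfl

theorem christoffel_comm (g : Metric E M) (x : M) (u v : T E x) :
    christoffel g x u v = christoffel g x v u := by
  simp only [christoffel_eq]
  refine Finset.sum_congr rfl fun k _ ↦ ?_
  rw [dInner_comm g x _ u v, add_comm (dInner g x u v _)]

theorem christoffel_add_left (g : Metric E M) (x : M) (u u' v : T E x) :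
    christoffel g x (u + u') v = christoffel g x u v + christoffel g x u' v := by
  simp only [christoffel_eq, ← Finset.sum_add_distrib]
  refine Finset.sum_congr rfl fun k _ ↦ ?_
  rw [dInner_add₁, dInner_add₂, dInner_add₂, ← add_smul]
  congr 1
  ring

theorem christoffel_smul_left (g : Metric E M) (x : M) (c : ℝ) (u v : T E x) :
    christoffel g x (c • u) v = c • christoffel g x u v := by
  simp only [christoffel_eq, Finset.smul_sum]
  refine Finset.sum_congr rfl fun k _ ↦ ?_
  rw [dInner_smul₁, dInner_smul₂, dInner_smul₂, smul_smul]
  congr 1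
  ring

theorem christoffel_add_right (g : Metric E M) (x : M) (u v v' : T E x) :
    christoffel g x u (v + v') = christoffel g x u v + christoffel g x u v' := by
  simp only [christoffel_comm g x u, christoffel_add_left]

theorem christoffel_smul_right (g : Metric E M) (x : M) (c : ℝ) (u v : T E x) :
    christoffel g x u (c • v) = c • christoffel g x u v := by
  simp only [christoffel_comm g x u, christoffel_smul_left]

/-- The characterization of the Christoffel symbols by their inner products. -/
theorem inner_christoffel (g : Metric E M) (x : M) (u v w : T E x) :
    g.inner x (christoffel g x u v) w
      = 1 / 2 * (dInner g x u v w + dInner g x v u w - dInner g x w u v) := by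
  -- Both sides are linear in `w`, so it suffices to test on the basis used to define `christoffel`.
  let L : T E x →ₗ[ℝ] ℝ :=
    { toFun := fun w ↦ 1 / 2 * (dInner g x u v w + dInner g x v u w - dInner g x w u v)
      map_add' := fun w w' ↦ by rw [dInner_add₁, dInner_add₃, dInner_add₃]; ring
      map_smul' := fun c w ↦ by
        rw [dInner_smul₁, dInner_smul₃, dInner_smul₃, RingHom.id_apply, smul_eq_mul]; ring }
  have h : (g.inner x (christoffel g x u v) : T E x →ₗ[ℝ] ℝ) = L := by
    refine (onb g x).ext fun k ↦ ?_
    simp only [ContinuousLinearMap.coe_coe, christoffel_eq, map_sum, map_smul,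
      sum_apply, smul_apply, onb_inner, smul_eq_mul]
    simp [L]
  exact congr($h w)

/-! ### The pull-back connection: linearity, Leibniz rule, chain rule -/

theorem diffAlong_id_iff {Y : (x : M) → T E x} {x : M} :
    DiffAlong E (id : M → M) Y x ↔
      MDifferentiableAt 𝓘(ℝ, E) (𝓘(ℝ, E).prod 𝓘(ℝ, E)) (fun y ↦ TotalSpace.mk' E y (Y y)) x :=
  (mdifferentiableAt_section _ Y).symm

theorem diffAlong_iff {φ : M → N} {p : M} (hφ : MDifferentiableAt 𝓘(ℝ, E) 𝓘(ℝ, F) φ p)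
    {V : (p : M) → T F (φ p)} :
    DiffAlong E φ V p ↔ MDifferentiableAt 𝓘(ℝ, E) (𝓘(ℝ, F).prod 𝓘(ℝ, F))
      (fun p' ↦ TotalSpace.mk' F (φ p') (V p')) p :=
  ⟨fun h ↦ (mdifferentiableAt_totalSpace _ _).2 ⟨hφ, h⟩,
    fun h ↦ ((mdifferentiableAt_totalSpace _ _).1 h).2⟩

theorem eventually_mem_baseSet {φ : M → N} {p : M} (hφ : ContinuousAt φ p) :
    ∀ᶠ p' in 𝓝 p,
      φ p' ∈ (trivializationAt F (fun y : N ↦ TangentSpace 𝓘(ℝ, F) y) (φ p)).baseSet :=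
  hφ ((trivializationAt F (fun y : N ↦ TangentSpace 𝓘(ℝ, F) y) (φ p)).open_baseSet.mem_nhds
    (FiberBundle.mem_baseSet_trivializationAt' (φ p)))

theorem coord_add {φ : M → N} {p : M} (hφ : ContinuousAt φ p) (V W : (p : M) → T F (φ p)) :
    coord φ (fun p' ↦ V p' + W p') p =ᶠ[𝓝 p] coord φ V p + coord φ W p := by
  filter_upwards [eventually_mem_baseSet (F := F) hφ] with p' hp'
  exact ((trivializationAt F (fun y : N ↦ TangentSpace 𝓘(ℝ, F) y) (φ p)).linear ℝ hp').map_add _ _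

theorem coord_smul {φ : M → N} {p : M} (hφ : ContinuousAt φ p) (f : M → ℝ)
    (V : (p : M) → T F (φ p)) :
    coord φ (fun p' ↦ f p' • V p') p =ᶠ[𝓝 p] f • coord φ V p := by
  filter_upwards [eventually_mem_baseSet (F := F) hφ] with p' hp'
  exact ((trivializationAt F (fun y : N ↦ TangentSpace 𝓘(ℝ, F) y) (φ p)).linear ℝ hp').map_smul _ _

theorem coord_congr {φ : M → N} {p : M} {V W : (p : M) → T F (φ p)}
    (h : ∀ᶠ p' in 𝓝 p, V p' = W p') : coord φ V p =ᶠ[𝓝 p] coord φ W p := by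
  filter_upwards [h] with p' hp'
  simp [coord, hp']

theorem DiffAlong.congr {φ : M → N} {p : M} {V W : (p : M) → T F (φ p)}
    (hV : DiffAlong E φ V p) (h : ∀ᶠ p' in 𝓝 p, W p' = V p') : DiffAlong E φ W p :=
  MDifferentiableAt.congr_of_eventuallyEq hV (coord_congr h)

theorem DiffAlong.add {φ : M → N} {p : M} (hφ : ContinuousAt φ p) {V W : (p : M) → T F (φ p)}
    (hV : DiffAlong E φ V p) (hW : DiffAlong E φ W p) :
    DiffAlong E φ (fun p' ↦ V p' + W p') p :=
  (MDifferentiableAt.add hV hW).congr_of_eventuallyEq (coord_add hφ V W)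

theorem DiffAlong.smul {φ : M → N} {p : M} (hφ : ContinuousAt φ p) {f : M → ℝ}
    (hf : MDifferentiableAt 𝓘(ℝ, E) 𝓘(ℝ) f p) {V : (p : M) → T F (φ p)}
    (hV : DiffAlong E φ V p) : DiffAlong E φ (fun p' ↦ f p' • V p') p :=
  (MDifferentiableAt.smul hf hV).congr_of_eventuallyEq (coord_smul hφ f V)

/-- Trades `symm` for the continuous linear map `symmL`, so that linearity can be used. -/
theorem pullbackCov_eq (h : Metric F N) (φ : M → N) (V : (p : M) → T F (φ p)) (p : M) (u : T E p) :
    pullbackCov h φ V p u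
      = (trivializationAt F (fun y : N ↦ TangentSpace 𝓘(ℝ, F) y) (φ p)).symmL ℝ (φ p)
          (mvfderiv 𝓘(ℝ, E) (coord φ V p) p u)
        + christoffel h (φ p) (mfderiv 𝓘(ℝ, E) 𝓘(ℝ, F) φ p u) (V p) := by
  rw [Trivialization.symmL_apply _ (FiberBundle.mem_baseSet_trivializationAt' (φ p))]
  rfl

theorem symmL_coord (φ : M → N) (V : (p : M) → T F (φ p)) (p : M) :
    (trivializationAt F (fun y : N ↦ TangentSpace 𝓘(ℝ, F) y) (φ p)).symmL ℝ (φ p) (coord φ V p p)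
      = V p := by
  rw [Trivialization.symmL_apply _ (FiberBundle.mem_baseSet_trivializationAt' (φ p))]
  exact Trivialization.symm_proj_apply _ (⟨φ p, V p⟩ : TotalSpace F _)
    (FiberBundle.mem_baseSet_trivializationAt' (φ p))

section

variable (h : Metric F N) {φ : M → N} {p : M}

theorem pullbackCov_add_dir (V : (p : M) → T F (φ p)) (u u' : T E p) :
    pullbackCov h φ V p (u + u') = pullbackCov h φ V p u + pullbackCov h φ V p u' := by
  simp only [pullbackCov_eq, map_add, christoffel_add_left]
  abel

theorem pullbackCov_smul_dir (V : (p : M) → T F (φ p)) (c : ℝ) (u : T E p) :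
    pullbackCov h φ V p (c • u) = c • pullbackCov h φ V p u := by
  simp only [pullbackCov_eq, map_smul, christoffel_smul_left, smul_add]

theorem pullbackCov_congr {V W : (p : M) → T F (φ p)} (hVW : ∀ᶠ p' in 𝓝 p, V p' = W p')
    (u : T E p) : pullbackCov h φ V p u = pullbackCov h φ W p u := by
  rw [pullbackCov_eq, pullbackCov_eq, mvfderiv_congr (coord_congr hVW), hVW.self_of_nhds]

theorem pullbackCov_add (hφ : ContinuousAt φ p) {V W : (p : M) → T F (φ p)}
    (hV : DiffAlong E φ V p) (hW : DiffAlong E φ W p) (u : T E p) :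
    pullbackCov h φ (fun p' ↦ V p' + W p') p u
      = pullbackCov h φ V p u + pullbackCov h φ W p u := by
  simp only [pullbackCov_eq, mvfderiv_congr (coord_add hφ V W), mvfderiv_add hV hW,
    christoffel_add_right, add_apply, map_add]
  abel

theorem pullbackCov_smul (hφ : ContinuousAt φ p) {f : M → ℝ}
    (hf : MDifferentiableAt 𝓘(ℝ, E) 𝓘(ℝ) f p) {V : (p : M) → T F (φ p)}
    (hV : DiffAlong E φ V p) (u : T E p) :
    pullbackCov h φ (fun p' ↦ f p' • V p') p u
      = f p • pullbackCov h φ V p u + mvfderiv 𝓘(ℝ, E) f p u • V p := by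
  simp only [pullbackCov_eq, mvfderiv_congr (coord_smul hφ f V), mvfderiv_smul hf hV,
    christoffel_smul_right, add_apply, map_add, smul_apply, map_smul,
    ContinuousLinearMap.smulRight_apply, symmL_coord, smul_add]
  abel

theorem pullbackCov_zero (u : T E p) (hφ : ContinuousAt φ p) :
    pullbackCov h φ (fun p' ↦ (0 : T F (φ p'))) p u = 0 := by
  have h0 : coord φ (fun p' ↦ (0 : T F (φ p'))) p =ᶠ[𝓝 p] 0 := by
    filter_upwards [eventually_mem_baseSet (F := F) hφ] with p' hp'
    exact ((trivializationAt F (fun y : N ↦ TangentSpace 𝓘(ℝ, F) y) (φ p)).linear ℝ hp').map_zero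
  have h1 : christoffel h (φ p) (mfderiv 𝓘(ℝ, E) 𝓘(ℝ, F) φ p u) 0 = 0 := by
    simpa using christoffel_smul_right h (φ p) 0 (mfderiv 𝓘(ℝ, E) 𝓘(ℝ, F) φ p u) 0
  rw [pullbackCov_eq, mvfderiv_congr h0, h1]
  simp

theorem diffAlong_zero (hφ : ContinuousAt φ p) :
    DiffAlong E φ (fun p' ↦ (0 : T F (φ p'))) p := by
  refine MDifferentiableAt.congr_of_eventuallyEq (f := fun _ ↦ (0 : F)) mdifferentiableAt_const ?_
  filter_upwards [eventually_mem_baseSet (F := F) hφ] with p' hp'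
  exact ((trivializationAt F (fun y : N ↦ TangentSpace 𝓘(ℝ, F) y) (φ p)).linear ℝ hp').map_zero

theorem DiffAlong.sum (hφ : ContinuousAt φ p) {ι : Type*} (s : Finset ι)
    {V : ι → (p : M) → T F (φ p)} (hV : ∀ i, DiffAlong E φ (V i) p) :
    DiffAlong E φ (fun p' ↦ ∑ i ∈ s, V i p') p := by
  classical
  induction s using Finset.induction_on with
  | empty => simpa using diffAlong_zero hφ
  | insert i s hi ih =>
    simp only [Finset.sum_insert hi]
    exact (hV i).add hφ ih

theorem pullbackCov_sum (hφ : ContinuousAt φ p) {ι : Type*} (s : Finset ι)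
    {V : ι → (p : M) → T F (φ p)} (hV : ∀ i, DiffAlong E φ (V i) p) (u : T E p) :
    pullbackCov h φ (fun p' ↦ ∑ i ∈ s, V i p') p u = ∑ i ∈ s, pullbackCov h φ (V i) p u := by
  classical
  induction s using Finset.induction_on with
  | empty => simpa using pullbackCov_zero h u hφ
  | insert i s hi ih =>
    simp only [Finset.sum_insert hi]
    rw [pullbackCov_add h hφ (hV i) (DiffAlong.sum hφ s hV), ih]

/-- Definitional, because both sides use the trivialization centred at `φ p`. The chain rule for the
connection thereby reduces to the one for functions. -/
theorem coord_comp (W : (y : N) → T F y) :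
    coord φ (fun p' ↦ W (φ p')) p = coord (id : N → N) W (φ p) ∘ φ := rfl

theorem DiffAlong.comp (hφ : MDifferentiableAt 𝓘(ℝ, E) 𝓘(ℝ, F) φ p) {W : (y : N) → T F y}
    (hW : DiffAlong F (id : N → N) W (φ p)) : DiffAlong E φ (fun p' ↦ W (φ p')) p :=
  MDifferentiableAt.comp (f := φ) (g := coord (id : N → N) W (φ p)) p hW hφ

/-- The chain rule for the pull-back connection. -/
theorem pullbackCov_comp (hφ : MDifferentiableAt 𝓘(ℝ, E) 𝓘(ℝ, F) φ p) {W : (y : N) → T F y}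
    (hW : DiffAlong F (id : N → N) W (φ p)) (u : T E p) :
    pullbackCov h φ (fun p' ↦ W (φ p')) p u
      = leviCivita h W (φ p) (mfderiv 𝓘(ℝ, E) 𝓘(ℝ, F) φ p u) := by
  have h1 : mvfderiv 𝓘(ℝ, E) (coord (id : N → N) W (φ p) ∘ φ) p u
      = mvfderiv 𝓘(ℝ, F) (coord (id : N → N) W (φ p)) (φ p)
        (mfderiv 𝓘(ℝ, E) 𝓘(ℝ, F) φ p u) :=
    mfderiv_comp_apply p hW hφ u
  have h2 := pullbackCov_eq h (id : N → N) W (φ p) (mfderiv 𝓘(ℝ, E) 𝓘(ℝ, F) φ p u)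
  rw [mfderiv_id] at h2
  rw [pullbackCov_eq, coord_comp, h1]
  exact h2.symm

end

/-! ### The Levi-Civita connection: compatibility, torsion, Koszul formula -/

theorem coord_ext {x : M} (v : T E x) :
    coord (id : M → M) (ext v) x =ᶠ[𝓝 x] fun _ ↦
      (trivializationAt E (fun x : M ↦ TangentSpace 𝓘(ℝ, E) x) x ⟨x, v⟩).2 := by
  set t := trivializationAt E (fun x : M ↦ TangentSpace 𝓘(ℝ, E) x) x with ht
  have hx : x ∈ t.baseSet := FiberBundle.mem_baseSet_trivializationAt' x
  filter_upwards [t.open_baseSet.mem_nhds hx] with y hy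
  simp [coord, FiberBundle.extend, ← ht, hy]

theorem leviCivita_ext (g : Metric E M) {x : M} (u v : T E x) :
    leviCivita g (ext v) x u = christoffel g x u v := by
  rw [leviCivita, pullbackCov_eq, mvfderiv_congr (coord_ext v), mvfderiv_const, mfderiv_id]
  simp

/-- The trivialization of the tangent bundle acts on fibres as the differential of the chart, so
constant coefficients there mean a constant field in the chart. -/
theorem mpullbackWithin_ext {x : M} (v : T E x) :
    ∀ᶠ z in 𝓝 (extChartAt 𝓘(ℝ, E) x x),
      VectorField.mpullbackWithin 𝓘(ℝ, E) 𝓘(ℝ, E) (extChartAt 𝓘(ℝ, E) x).symm (ext v)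
        (Set.range 𝓘(ℝ, E)) z
        = (trivializationAt E (fun x : M ↦ TangentSpace 𝓘(ℝ, E) x) x ⟨x, v⟩).2 := by
  set t := trivializationAt E (fun x : M ↦ TangentSpace 𝓘(ℝ, E) x) x with ht
  filter_upwards [extChartAt_target_mem_nhds (I := 𝓘(ℝ, E)) x] with z hz
  have hy : (extChartAt 𝓘(ℝ, E) x).symm z ∈ (chartAt E x).source := by
    simpa using (extChartAt 𝓘(ℝ, E) x).map_target hz
  -- `inverse` is zero on non-invertible maps, so both composites with the differential of the chart
  -- have to be known.
  have hinv : (mfderivWithin 𝓘(ℝ, E) 𝓘(ℝ, E) (extChartAt 𝓘(ℝ, E) x).symm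
      (Set.range 𝓘(ℝ, E)) z).inverse
      = mfderiv 𝓘(ℝ, E) 𝓘(ℝ, E) (extChartAt 𝓘(ℝ, E) x) ((extChartAt 𝓘(ℝ, E) x).symm z) :=
    ContinuousLinearMap.inverse_eq
      (mfderivWithin_extChartAt_symm_comp_mfderiv_extChartAt hz)
      (mfderiv_extChartAt_comp_mfderivWithin_extChartAt_symm hz)
  have hb : (extChartAt 𝓘(ℝ, E) x).symm z ∈ t.baseSet := by
    simpa [ht] using hy
  have h1 := congr($(TangentBundle.continuousLinearMapAt_trivializationAt (I := 𝓘(ℝ, E)) hy)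
    (ext v ((extChartAt 𝓘(ℝ, E) x).symm z)))
  rw [VectorField.mpullbackWithin_apply, hinv]
  refine h1.symm.trans ?_
  rw [Trivialization.continuousLinearMapAt_apply_of_mem _ _ hb]
  have h2 := congrArg Prod.snd (t.apply_mk_symm hb (t ⟨x, v⟩).2)
  exact h2

/-- Coordinate vector fields commute. -/
theorem mlieBracket_ext {x : M} (u v : T E x) :
    VectorField.mlieBracket 𝓘(ℝ, E) (ext u) (ext v) x = 0 := by
  rw [← VectorField.mlieBracketWithin_univ, VectorField.mlieBracketWithin_apply]
  have h := Filter.EventuallyEq.lieBracketWithin_vectorField_eq_of_mem (𝕜 := ℝ)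
    (s := (extChartAt 𝓘(ℝ, E) x).symm ⁻¹' Set.univ ∩ Set.range 𝓘(ℝ, E))
    (V := fun _ : E ↦ (trivializationAt E (fun x : M ↦ TangentSpace 𝓘(ℝ, E) x) x ⟨x, u⟩).2)
    (W := fun _ : E ↦ (trivializationAt E (fun x : M ↦ TangentSpace 𝓘(ℝ, E) x) x ⟨x, v⟩).2)
    (nhdsWithin_le_nhds (mpullbackWithin_ext u)) (nhdsWithin_le_nhds (mpullbackWithin_ext v))
    (by simp)
  have h0 : VectorField.lieBracketWithin ℝ
      (fun _ : E ↦ (trivializationAt E (fun x : M ↦ TangentSpace 𝓘(ℝ, E) x) x ⟨x, u⟩).2)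
      (fun _ : E ↦ (trivializationAt E (fun x : M ↦ TangentSpace 𝓘(ℝ, E) x) x ⟨x, v⟩).2)
      ((extChartAt 𝓘(ℝ, E) x).symm ⁻¹' Set.univ ∩ Set.range 𝓘(ℝ, E))
      (extChartAt 𝓘(ℝ, E) x x) = 0 := by
    simp [VectorField.lieBracketWithin]
  rw [h, h0]
  exact map_zero (mfderiv 𝓘(ℝ, E) 𝓘(ℝ, E) (extChartAt 𝓘(ℝ, E) x) x).inverse

theorem leviCivita_add (g : Metric E M) {x : M} {Y Z : (x : M) → T E x}
    (hY : DiffAlong E (id : M → M) Y x) (hZ : DiffAlong E (id : M → M) Z x) (u : T E x) :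
    leviCivita g (Y + Z) x u = leviCivita g Y x u + leviCivita g Z x u :=
  pullbackCov_add g continuousAt_id hY hZ u

theorem leviCivita_smul (g : Metric E M) {x : M} {f : M → ℝ} {Y : (x : M) → T E x}
    (hf : MDifferentiableAt 𝓘(ℝ, E) 𝓘(ℝ) f x) (hY : DiffAlong E (id : M → M) Y x) (u : T E x) :
    leviCivita g (f • Y) x u = f x • leviCivita g Y x u + mvfderiv 𝓘(ℝ, E) f x u • Y x :=
  pullbackCov_smul g continuousAt_id hf hY u

theorem leviCivita_add_dir (g : Metric E M) {x : M} (Y : (x : M) → T E x) (u u' : T E x) :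
    leviCivita g Y x (u + u') = leviCivita g Y x u + leviCivita g Y x u' :=
  pullbackCov_add_dir g (φ := id) Y u u'

theorem leviCivita_smul_dir (g : Metric E M) {x : M} (Y : (x : M) → T E x) (c : ℝ) (u : T E x) :
    leviCivita g Y x (c • u) = c • leviCivita g Y x u :=
  pullbackCov_smul_dir g (φ := id) Y c u

/-- The defect of metric compatibility is tensorial. -/
theorem tensorialAt_metric_defect (g : Metric E M) {x : M} (u : T E x) {Z : (x : M) → T E x}
    (hZ : MDifferentiableAt 𝓘(ℝ, E) (𝓘(ℝ, E).prod 𝓘(ℝ, E)) (fun y ↦ TotalSpace.mk' E y (Z y)) x) :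
    TensorialAt 𝓘(ℝ, E) E (fun Y : (x : M) → T E x ↦
      mvfderiv 𝓘(ℝ, E) (fun y ↦ g.inner y (Y y) (Z y)) x u
        - g.inner x (leviCivita g Y x u) (Z x) - g.inner x (Y x) (leviCivita g Z x u)) x where
  smul {f Y} hf hY := by
    simp only [leviCivita_smul g hf (diffAlong_id_iff.2 hY), Pi.smul_apply', map_add, map_smul,
      smul_apply, add_apply, smul_eq_mul]
    rw [mvfderiv_fun_mul hf (mdifferentiableAt_inner g hY hZ)]
    simp only [smul_apply, add_apply, smul_eq_mul]
    ring
  add {Y Y'} hY hY' := by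
    simp only [leviCivita_add g (diffAlong_id_iff.2 hY) (diffAlong_id_iff.2 hY'), Pi.add_apply,
      map_add, add_apply]
    rw [mvfderiv_fun_add (mdifferentiableAt_inner g hY hZ) (mdifferentiableAt_inner g hY' hZ)]
    simp only [add_apply]
    ring

/-- The defect of compatibility depends only on the values at `x`, so both fields may be replaced by
constant-coefficient ones; there the identity follows from the formula for the Christoffel symbols.
-/
theorem mvfderiv_inner (g : Metric E M) {x : M} (u : T E x) {Y Z : (x : M) → T E x}
    (hY : MDifferentiableAt 𝓘(ℝ, E) (𝓘(ℝ, E).prod 𝓘(ℝ, E)) (fun y ↦ TotalSpace.mk' E y (Y y)) x)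
    (hZ : MDifferentiableAt 𝓘(ℝ, E) (𝓘(ℝ, E).prod 𝓘(ℝ, E)) (fun y ↦ TotalSpace.mk' E y (Z y)) x) :
    mvfderiv 𝓘(ℝ, E) (fun y ↦ g.inner y (Y y) (Z y)) x u
      = g.inner x (leviCivita g Y x u) (Z x) + g.inner x (Y x) (leviCivita g Z x u) := by
  have h0 (v w : T E x) : mvfderiv 𝓘(ℝ, E) (fun y ↦ g.inner y (ext v y) (ext w y)) x u
      = g.inner x (leviCivita g (ext v) x u) (ext w x)
        + g.inner x (ext v x) (leviCivita g (ext w) x u) := by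
    rw [leviCivita_ext, leviCivita_ext, ext_self, ext_self, inner_christoffel, g.symm x v,
      inner_christoffel, dInner_comm g x u w v, dInner_comm g x w u v, dInner_comm g x v u w]
    rw [← dInner]
    ring
  have h1 (v : T E x) := (tensorialAt_metric_defect g u (mdifferentiableAt_ext v)).pointwise
    hY (mdifferentiableAt_ext (Y x)) (ext_self (Y x)).symm
  -- The second slot is handled by the same lemma, with the roles of the fields exchanged by
  -- symmetry of the metric.
  have h2 := (tensorialAt_metric_defect g u hY).pointwise
    hZ (mdifferentiableAt_ext (Z x)) (ext_self (Z x)).symm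
  have h3 := h1 (Z x)
  simp only [h0] at h3
  simp only [g.symm _ (Z _) (Y _), g.symm _ (ext (Z x) _) (Y _),
    g.symm _ (leviCivita g _ _ _) (Y _), g.symm _ _ (leviCivita g Y _ _)] at h2
  linarith

theorem tensorialAt_torsion (g : Metric E M) {x : M} (Z : (x : M) → T E x) :
    TensorialAt 𝓘(ℝ, E) E (fun Y : (x : M) → T E x ↦
      leviCivita g Z x (Y x) - leviCivita g Y x (Z x)
        - VectorField.mlieBracket 𝓘(ℝ, E) Y Z x) x where
  smul {f Y} hf hY := by
    simp only [leviCivita_smul g hf (diffAlong_id_iff.2 hY), Pi.smul_apply', leviCivita_smul_dir,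
      VectorField.mlieBracket_smul_left hf hY]
    module
  add {Y Y'} hY hY' := by
    simp only [leviCivita_add g (diffAlong_id_iff.2 hY) (diffAlong_id_iff.2 hY'), Pi.add_apply,
      leviCivita_add_dir, VectorField.mlieBracket_add_left hY hY']
    module

/-- Torsion is tensorial in one slot, hence by antisymmetry in the other. On coordinate fields the
bracket vanishes and the Christoffel symbols are symmetric. -/
theorem leviCivita_sub_leviCivita (g : Metric E M) {x : M} {Y Z : (x : M) → T E x}
    (hY : MDifferentiableAt 𝓘(ℝ, E) (𝓘(ℝ, E).prod 𝓘(ℝ, E)) (fun y ↦ TotalSpace.mk' E y (Y y)) x)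
    (hZ : MDifferentiableAt 𝓘(ℝ, E) (𝓘(ℝ, E).prod 𝓘(ℝ, E)) (fun y ↦ TotalSpace.mk' E y (Z y)) x) :
    leviCivita g Z x (Y x) - leviCivita g Y x (Z x) = VectorField.mlieBracket 𝓘(ℝ, E) Y Z x := by
  have h1 := (tensorialAt_torsion g (ext (Z x))).pointwise
    hY (mdifferentiableAt_ext (Y x)) (ext_self (Y x)).symm
  have h2 := (tensorialAt_torsion g Y).pointwise
    hZ (mdifferentiableAt_ext (Z x)) (ext_self (Z x)).symm
  simp only [ext_self, leviCivita_ext, mlieBracket_ext, christoffel_comm g x (Y x),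
    sub_self] at h1 h2
  rw [VectorField.mlieBracket_swap_apply (V := Z),
    VectorField.mlieBracket_swap_apply (V := ext (Z x))] at h2
  have h3 : leviCivita g Z x (Y x) - leviCivita g Y x (Z x)
      - VectorField.mlieBracket 𝓘(ℝ, E) Y Z x = 0 := by
    rw [← neg_eq_zero, ← neg_eq_zero.2 h1]
    calc _ = leviCivita g Y x (Z x) - leviCivita g Z x (Y x)
        - -VectorField.mlieBracket 𝓘(ℝ, E) Y Z x := by abel
      _ = _ := by rw [h2]; abel
  exact sub_eq_zero.1 h3

/-- The Koszul formula. -/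
theorem koszul (g : Metric E M) {x : M} {X Y Z : (x : M) → T E x}
    (hX : MDifferentiableAt 𝓘(ℝ, E) (𝓘(ℝ, E).prod 𝓘(ℝ, E)) (fun y ↦ TotalSpace.mk' E y (X y)) x)
    (hY : MDifferentiableAt 𝓘(ℝ, E) (𝓘(ℝ, E).prod 𝓘(ℝ, E)) (fun y ↦ TotalSpace.mk' E y (Y y)) x)
    (hZ : MDifferentiableAt 𝓘(ℝ, E) (𝓘(ℝ, E).prod 𝓘(ℝ, E)) (fun y ↦ TotalSpace.mk' E y (Z y)) x) :
    g.inner x (leviCivita g Y x (X x)) (Z x) = 1 / 2 *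
      (mvfderiv 𝓘(ℝ, E) (fun y ↦ g.inner y (Y y) (Z y)) x (X x)
        + mvfderiv 𝓘(ℝ, E) (fun y ↦ g.inner y (X y) (Z y)) x (Y x)
        - mvfderiv 𝓘(ℝ, E) (fun y ↦ g.inner y (X y) (Y y)) x (Z x)
        + g.inner x (VectorField.mlieBracket 𝓘(ℝ, E) X Y x) (Z x)
        - g.inner x (VectorField.mlieBracket 𝓘(ℝ, E) X Z x) (Y x)
        - g.inner x (VectorField.mlieBracket 𝓘(ℝ, E) Y Z x) (X x)) := by
  rw [mvfderiv_inner g _ hY hZ, mvfderiv_inner g _ hX hZ, mvfderiv_inner g _ hX hY,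
    ← leviCivita_sub_leviCivita g hX hY, ← leviCivita_sub_leviCivita g hX hZ,
    ← leviCivita_sub_leviCivita g hY hZ]
  simp only [map_sub, sub_apply, g.symm x (Y x), g.symm x (X x)]
  ring

/-! ### Smoothness of derived fields -/

/-- The image of a smooth vector field under the differential of a smooth map is smooth. -/
theorem contMDiffAt_mfderiv_apply {φ : M → N} {p : M} (hφ : ContMDiffAt 𝓘(ℝ, E) 𝓘(ℝ, F) ∞ φ p)
    {X : (p : M) → T E p}
    (hX : ContMDiffAt 𝓘(ℝ, E) (𝓘(ℝ, E).prod 𝓘(ℝ, E)) ∞ (fun y ↦ TotalSpace.mk' E y (X y)) p) :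
    ContMDiffAt 𝓘(ℝ, E) (𝓘(ℝ, F).prod 𝓘(ℝ, F)) ∞
      (fun p' ↦ TotalSpace.mk' F (φ p') (mfderiv 𝓘(ℝ, E) 𝓘(ℝ, F) φ p' (X p'))) p :=
  ContMDiffAt.clm_apply_of_inCoordinates (b₁ := id) (b₂ := φ)
    (E₁ := fun x : M ↦ TangentSpace 𝓘(ℝ, E) x) (E₂ := fun x : N ↦ TangentSpace 𝓘(ℝ, F) x)
    (ϕ := fun p' ↦ mfderiv 𝓘(ℝ, E) 𝓘(ℝ, F) φ p')
    (hφ.mfderiv_const (m := ∞) (by simp)) hX hφ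

theorem contMDiffAt_mvfderiv_apply {f : M → ℝ} {p : M} (hf : ContMDiffAt 𝓘(ℝ, E) 𝓘(ℝ) ∞ f p)
    {X : (p : M) → T E p}
    (hX : ContMDiffAt 𝓘(ℝ, E) (𝓘(ℝ, E).prod 𝓘(ℝ, E)) ∞ (fun y ↦ TotalSpace.mk' E y (X y)) p) :
    ContMDiffAt 𝓘(ℝ, E) 𝓘(ℝ) ∞ (fun p' ↦ mvfderiv 𝓘(ℝ, E) f p' (X p')) p :=
  (contMDiff_snd_tangentBundle_modelSpace ℝ 𝓘(ℝ)).contMDiffAt.comp p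
    (contMDiffAt_mfderiv_apply hf hX)

theorem contMDiffAt_mlieBracket {p : M} {X Y : (p : M) → T E p}
    (hX : ContMDiffAt 𝓘(ℝ, E) (𝓘(ℝ, E).prod 𝓘(ℝ, E)) ∞ (fun y ↦ TotalSpace.mk' E y (X y)) p)
    (hY : ContMDiffAt 𝓘(ℝ, E) (𝓘(ℝ, E).prod 𝓘(ℝ, E)) ∞ (fun y ↦ TotalSpace.mk' E y (Y y)) p) :
    ContMDiffAt 𝓘(ℝ, E) (𝓘(ℝ, E).prod 𝓘(ℝ, E)) ∞
      (fun y ↦ TotalSpace.mk' E y (VectorField.mlieBracket 𝓘(ℝ, E) X Y y)) p := by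
  have : IsManifold 𝓘(ℝ, E) ((⊤ : ℕ∞) + 1 : WithTop ℕ∞) M := by simpa
  have : IsManifold 𝓘(ℝ, E) (minSmoothness ℝ 2) M := by
    rw [minSmoothness_of_isRCLikeNormedField]; infer_instance
  exact ContMDiffAt.mlieBracket_vectorField (m := ⊤) (n := ⊤) hX hY (by simp)

/-! ### Orthonormal families and traces -/

section linear

variable (g : Metric E M) {x : M} {e : Fin (finrank ℝ E) → T E x}

/-- The expansion of a vector in an orthonormal family of the right cardinality. -/
theorem sum_inner_smul (he : ∀ i j, g.inner x (e i) (e j) = if i = j then 1 else 0) (v : T E x) :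
    ∑ i, g.inner x v (e i) • e i = v := by
  have hli : LinearIndependent ℝ e := by
    rw [Fintype.linearIndependent_iff]
    intro c hc j
    have := congr(g.inner x $hc (e j))
    simpa [map_sum, sum_apply, he] using this
  have : FiniteDimensional ℝ (T E x) := inferInstanceAs (FiniteDimensional ℝ E)
  let b := basisOfLinearIndependentOfCardEqFinrank' e hli
    ((Fintype.card_fin _).trans (rfl : finrank ℝ E = finrank ℝ (T E x)))
  have hb (i) : b i = e i := by simp [b]
  have hv (j) : g.inner x v (e j) = b.repr v j := by
    conv_lhs => rw [← b.sum_repr v]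
    simp [map_sum, sum_apply, he, hb]
  conv_rhs => rw [← b.sum_repr v]
  simp only [hv, hb]

theorem inner_eq_sum (he : ∀ i j, g.inner x (e i) (e j) = if i = j then 1 else 0) (v w : T E x) :
    ∑ i, g.inner x (e i) v * g.inner x (e i) w = g.inner x v w := by
  conv_rhs => rw [← sum_inner_smul g he v]
  simp [map_sum, sum_apply, g.symm x v]

/-- The trace of a bilinear form can be computed after pulling back along a linear map `A` with
`A A^* = 1`. -/
theorem sum_comp_eq_sum (h : Metric F N) {y : N} (A : T E x →ₗ[ℝ] T F y)
    (he : ∀ i j, g.inner x (e i) (e j) = if i = j then 1 else 0)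
    {f : Fin (finrank ℝ F) → T F y} (hf : ∀ i j, h.inner y (f i) (f j) = if i = j then 1 else 0)
    {ξ : Fin (finrank ℝ F) → T E x} (hξ : ∀ v a, h.inner y (A v) (f a) = g.inner x v (ξ a))
    (hA : ∀ a, A (ξ a) = f a) {V : Type*} [AddCommGroup V] [Module ℝ V]
    (B : T F y →ₗ[ℝ] T F y →ₗ[ℝ] V) :
    ∑ i, B (A (e i)) (A (e i)) = ∑ a, B (f a) (f a) := by
  have h1 (i) : A (e i) = ∑ a, g.inner x (e i) (ξ a) • f a := by
    simp only [← hξ, sum_inner_smul h hf]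
  calc ∑ i, B (A (e i)) (A (e i))
      = ∑ i, ∑ b, ∑ a, (g.inner x (e i) (ξ a) * g.inner x (e i) (ξ b)) • B (f a) (f b) := by
        refine Finset.sum_congr rfl fun i _ ↦ ?_
        rw [h1]
        simp only [map_sum, LinearMap.sum_apply, map_smul, LinearMap.smul_apply, Finset.smul_sum,
          smul_smul]
        refine Finset.sum_congr rfl fun b _ ↦ Finset.sum_congr rfl fun a _ ↦ ?_
        rw [mul_comm]
    _ = ∑ b, ∑ a, (∑ i, g.inner x (e i) (ξ a) * g.inner x (e i) (ξ b)) • B (f a) (f b) := by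
        rw [Finset.sum_comm]
        refine Finset.sum_congr rfl fun b _ ↦ ?_
        rw [Finset.sum_comm]
        simp only [Finset.sum_smul]
    _ = ∑ a, B (f a) (f a) := by
        -- The vectors `ξ a` are the images of `f a` under the adjoint of `A`; they are orthonormal
        -- because `A A^* = 1`.
        have h2 (a b) : g.inner x (ξ a) (ξ b) = if a = b then 1 else 0 := by rw [← hξ, hA, hf]
        simp only [inner_eq_sum g he, h2, ite_smul, one_smul, zero_smul,
          Finset.sum_ite_eq', Finset.mem_univ, if_true]

/-- The trace of a bilinear form does not depend on the orthonormal family. -/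
theorem sum_eq_sum {f : Fin (finrank ℝ E) → T E x}
    (he : ∀ i j, g.inner x (e i) (e j) = if i = j then 1 else 0)
    (hf : ∀ i j, g.inner x (f i) (f j) = if i = j then 1 else 0)
    {V : Type*} [AddCommGroup V] [Module ℝ V] (B : T E x →ₗ[ℝ] T E x →ₗ[ℝ] V) :
    ∑ i, B (e i) (e i) = ∑ a, B (f a) (f a) :=
  sum_comp_eq_sum g g LinearMap.id he hf (fun _ _ ↦ rfl) (fun _ ↦ rfl) B

end linear

/-! ### Smooth orthonormal frames and smoothness of the connection -/

/-- The Gram-Schmidt process, stopped after `k` steps: the first `k` fields are orthonormal to all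
of the fields. -/
theorem exists_partial_orthonormal_frame (g : Metric E M) (q : M) (k : ℕ) :
    ∃ e : Fin (finrank ℝ E) → (y : M) → T E y,
      (∀ i, ContMDiffAt 𝓘(ℝ, E) (𝓘(ℝ, E).prod 𝓘(ℝ, E)) ∞ (fun y ↦ TotalSpace.mk' E y (e i y)) q)
      ∧ (∀ i, e i q = onb g q i)
      ∧ ∀ᶠ y in 𝓝 q, ∀ i j : Fin (finrank ℝ E), i.val < k →
          g.inner y (e i y) (e j y) = if i = j then 1 else 0 := by
  induction k with
  | zero =>
    exact ⟨fun i ↦ ext (onb g q i), fun i ↦ contMDiffAt_ext _, fun i ↦ ext_self _,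
      Filter.Eventually.of_forall fun y i j hi ↦ absurd hi (by simp)⟩
  | succ k ih =>
    obtain ⟨e, he, heq, ho⟩ := ih
    by_cases hk : k < finrank ℝ E
    swap
    · refine ⟨e, he, heq, ho.mono fun y hy i j _ ↦ hy i j (by omega)⟩
    let κ : Fin (finrank ℝ E) := ⟨k, hk⟩
    let c : M → ℝ := fun y ↦ (√(g.inner y (e κ y) (e κ y)))⁻¹
    let w : (y : M) → T E y := fun y ↦ c y • e κ y
    -- The frame keeps its orthonormal values at `q` throughout the induction. So the norm is 1
    -- there and positive nearby, and the normalizing factor is smooth at `q`.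
    have hq : g.inner q (e κ q) (e κ q) = 1 := by rw [heq, onb_inner, if_pos rfl]
    have hin := contMDiffAt_inner g (he κ) (he κ)
    have hc : ContMDiffAt 𝓘(ℝ, E) 𝓘(ℝ) ∞ c q := by
      have hs : ContDiffAt ℝ ∞ (fun t : ℝ ↦ (√t)⁻¹) (g.inner q (e κ q) (e κ q)) := by
        rw [hq]
        exact (Real.contDiffAt_sqrt one_ne_zero).inv (by simp)
      exact ContMDiffAt.comp (g := fun t : ℝ ↦ (√t)⁻¹) q hs.contMDiffAt hin
    have hcq : c q = 1 := by simp [c, hq]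
    have hw := hc.smul_section (he κ)
    have hwq : w q = onb g q κ := by simp [w, hcq, heq]
    have hpos : ∀ᶠ y in 𝓝 q, 0 < g.inner y (e κ y) (e κ y) :=
      hin.continuousAt.eventually (lt_mem_nhds (one_pos.trans_eq hq.symm))
    -- Normalize field `k` and remove its component from all later fields. Earlier fields stay
    -- orthogonal to the new ones, since they were orthogonal to all the old ones.
    let e' : Fin (finrank ℝ E) → (y : M) → T E y := fun j ↦
      if j < κ then e j else if j = κ then w else e j - (fun y ↦ g.inner y (e j y) (w y)) • w
    have elt {j} (h : j < κ) : e' j = e j := if_pos h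
    have eeq : e' κ = w := by simp [e']
    have egt {j} (h : κ < j) : e' j = e j - (fun y ↦ g.inner y (e j y) (w y)) • w := by
      simp [e', h.not_gt, h.ne']
    refine ⟨e', fun j ↦ ?_, fun j ↦ ?_, ?_⟩
    · rcases lt_trichotomy j κ with h | rfl | h
      · rw [elt h]; exact he j
      · rw [eeq]; exact hw
      · rw [egt h]; exact (he j).sub_section ((contMDiffAt_inner g (he j) hw).smul_section hw)
    · rcases lt_trichotomy j κ with h | rfl | h
      · rw [elt h, heq]
      · rw [eeq, hwq]
      · simp [egt h, heq, hwq, onb_inner, h.ne']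
    · filter_upwards [ho, hpos] with y hy hyp i j hi
      have hww : g.inner y (w y) (w y) = 1 := by
        simp only [w, c, map_smul, smul_apply, smul_eq_mul]
        rw [← mul_assoc, ← mul_inv, Real.mul_self_sqrt hyp.le, inv_mul_cancel₀ hyp.ne']
      have hlow {i} (hi : i < κ) : g.inner y (e i y) (w y) = 0 := by
        simp [w, hy i κ hi, hi.ne]
      have hlow' {i} (hi : i < κ) : g.inner y (w y) (e i y) = 0 := by rw [g.symm, hlow hi]
      rcases lt_trichotomy i κ with h | rfl | h
      · rw [elt h]
        rcases lt_trichotomy j κ with h' | rfl | h'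
        · rw [elt h', hy i j h]
        · rw [eeq, hlow h, if_neg h.ne]
        · simp [egt h', hlow h, hy i j h]
      · rw [eeq]
        rcases lt_trichotomy j κ with h' | rfl | h'
        · rw [elt h', hlow' h', if_neg h'.ne']
        · rw [eeq, hww, if_pos rfl]
        · simp [egt h', hww, h'.ne, g.symm y (w y)]
      · exact absurd hi (by simpa [Fin.lt_def, κ] using h)

/-- Near every point there is a smooth orthonormal frame. -/
theorem exists_orthonormal_frame (g : Metric E M) (q : M) :
    ∃ e : Fin (finrank ℝ E) → (y : M) → T E y,
      (∀ i, ContMDiffAt 𝓘(ℝ, E) (𝓘(ℝ, E).prod 𝓘(ℝ, E)) ∞ (fun y ↦ TotalSpace.mk' E y (e i y)) q)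
      ∧ ∀ᶠ y in 𝓝 q, ∀ i j, g.inner y (e i y) (e j y) = if i = j then 1 else 0 := by
  obtain ⟨e, he, -, ho⟩ := exists_partial_orthonormal_frame g q (finrank ℝ E)
  exact ⟨e, he, ho.mono fun y hy i j ↦ hy i j i.isLt⟩

theorem eventually_mdifferentiableAt {p : M} {X : (p : M) → T E p}
    (hX : ContMDiffAt 𝓘(ℝ, E) (𝓘(ℝ, E).prod 𝓘(ℝ, E)) ∞ (fun y ↦ TotalSpace.mk' E y (X y)) p) :
    ∀ᶠ p' in 𝓝 p, MDifferentiableAt 𝓘(ℝ, E) (𝓘(ℝ, E).prod 𝓘(ℝ, E))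
      (fun y ↦ TotalSpace.mk' E y (X y)) p' :=
  ((contMDiffAt_iff_contMDiffAt_nhds (n := 1) (by simp)).1 (hX.of_le (by simp))).mono
    fun _ h ↦ h.mdifferentiableAt (by simp)

/-- The covariant derivative of smooth vector fields is smooth. -/
theorem contMDiffAt_leviCivita (g : Metric E M) {q : M} {X Y : (x : M) → T E x}
    (hX : ContMDiffAt 𝓘(ℝ, E) (𝓘(ℝ, E).prod 𝓘(ℝ, E)) ∞ (fun y ↦ TotalSpace.mk' E y (X y)) q)
    (hY : ContMDiffAt 𝓘(ℝ, E) (𝓘(ℝ, E).prod 𝓘(ℝ, E)) ∞ (fun y ↦ TotalSpace.mk' E y (Y y)) q) :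
    ContMDiffAt 𝓘(ℝ, E) (𝓘(ℝ, E).prod 𝓘(ℝ, E)) ∞
      (fun y ↦ TotalSpace.mk' E y (leviCivita g Y y (X y))) q := by
  obtain ⟨e, he, ho⟩ := exists_orthonormal_frame g q
  -- By the Koszul formula the frame coefficients of ∇_X Y are built from derivatives of inner
  -- products and brackets of smooth fields.
  have hcoef (i) : ContMDiffAt 𝓘(ℝ, E) 𝓘(ℝ) ∞
      (fun y ↦ g.inner y (leviCivita g Y y (X y)) (e i y)) q := by
    have h1 := ((((((contMDiffAt_mvfderiv_apply (contMDiffAt_inner g hY (he i)) hX).add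
      (contMDiffAt_mvfderiv_apply (contMDiffAt_inner g hX (he i)) hY)).sub
      (contMDiffAt_mvfderiv_apply (contMDiffAt_inner g hX hY) (he i))).add
      (contMDiffAt_inner g (contMDiffAt_mlieBracket hX hY) (he i))).sub
      (contMDiffAt_inner g (contMDiffAt_mlieBracket hX (he i)) hY)).sub
      (contMDiffAt_inner g (contMDiffAt_mlieBracket hY (he i)) hX))
    refine ((contMDiffAt_const (c := (1 / 2 : ℝ))).mul h1).congr_of_eventuallyEq ?_
    filter_upwards [eventually_mdifferentiableAt hX, eventually_mdifferentiableAt hY,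
      eventually_mdifferentiableAt (he i)] with y hXy hYy hey
    exact koszul g hXy hYy hey
  have hsum := ContMDiffAt.sum_section (s := Finset.univ)
    fun i _ ↦ (hcoef i).smul_section (he i)
  refine hsum.congr_of_eventuallyEq ?_
  filter_upwards [ho] with y hy
  exact congrArg (TotalSpace.mk' E y) (sum_inner_smul g hy _).symm

/-! ### Second covariant derivatives and composition with a map -/

/-- A differentiable section of `φ⁻¹TN` is a combination of coordinate vector fields with
differentiable coefficients. -/
theorem exists_frame_expansion {φ : M → N} {p : M} (hφ : ContinuousAt φ p)
    {V : (p : M) → T F (φ p)} (hV : DiffAlong E φ V p) :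
    ∃ (b : Fin (finrank ℝ F) → T F (φ p)) (c : Fin (finrank ℝ F) → M → ℝ),
      (∀ k, MDifferentiableAt 𝓘(ℝ, E) 𝓘(ℝ) (c k) p) ∧
      ∀ᶠ p' in 𝓝 p, V p' = ∑ k, c k p' • ext (b k) (φ p') := by
  set t := trivializationAt F (fun y : N ↦ TangentSpace 𝓘(ℝ, F) y) (φ p) with ht
  have hp : φ p ∈ t.baseSet := FiberBundle.mem_baseSet_trivializationAt' (φ p)
  let β := finBasis ℝ F
  -- The extension of `b k` has constant coordinates `β k`, so the coefficients of `V` are its own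
  -- coordinates.
  refine ⟨fun k ↦ t.symm (φ p) (β k), fun k p' ↦ β.repr (coord φ V p p') k, fun k ↦ ?_, ?_⟩
  · exact (LinearMap.toContinuousLinearMap (β.coord k)).contMDiff.mdifferentiableAt
      (n := ∞) (by simp) |>.comp p hV
  · filter_upwards [eventually_mem_baseSet (F := F) hφ] with p' hp'
    have h1 (k) : ext (t.symm (φ p) (β k)) (φ p') = t.symmL ℝ (φ p') (β k) := by
      rw [Trivialization.symmL_apply t hp']
      simp only [FiberBundle.extend, ← ht]
      rw [Trivialization.apply_mk_symm t hp]
    simp only [h1, ← map_smul, ← map_sum, β.sum_repr]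
    rw [Trivialization.symmL_apply t hp']
    exact (Trivialization.symm_proj_apply t (⟨φ p', V p'⟩ : TotalSpace F _) hp').symm

/-- The covariant derivative of `W` at `q` as a linear map. -/
def covDeriv (h : Metric F N) (W : (y : N) → T F y) (q : N) : T F q →ₗ[ℝ] T F q where
  toFun u := leviCivita h W q u
  map_add' := leviCivita_add_dir h W
  map_smul' := leviCivita_smul_dir h W

theorem diffAlong_leviCivita_ext (h : Metric F N) {W : (y : N) → T F y} {q : N}
    (hW : ContMDiffAt 𝓘(ℝ, F) (𝓘(ℝ, F).prod 𝓘(ℝ, F)) ∞ (fun y ↦ TotalSpace.mk' F y (W y)) q)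
    (b : T F q) : DiffAlong F (id : N → N) (fun y ↦ leviCivita h W y (ext b y)) q :=
  diffAlong_id_iff.2
    ((contMDiffAt_leviCivita h (contMDiffAt_ext b) hW).mdifferentiableAt (by simp))

theorem leviCivita_congr (h : Metric F N) {V W : (y : N) → T F y} {q : N}
    (hVW : ∀ᶠ y in 𝓝 q, V y = W y) (u : T F q) : leviCivita h V q u = leviCivita h W q u :=
  pullbackCov_congr h (φ := id) hVW u

theorem leviCivita_const_smul (h : Metric F N) {W : (y : N) → T F y} {q : N} (c : ℝ)
    (hW : DiffAlong F (id : N → N) W q) (u : T F q) :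
    leviCivita h (c • W) q u = c • leviCivita h W q u := by
  have h1 := leviCivita_smul h (f := fun _ ↦ c) mdifferentiableAt_const hW u
  rw [mvfderiv_const, zero_apply, zero_smul, add_zero] at h1
  exact h1

/-- The second covariant derivative `∇²W(a, b) = ∇_a ∇_b W - ∇_{∇_a b} W` at `q`. -/
def hessian (h : Metric F N) {W : (y : N) → T F y} {q : N}
    (hW : ContMDiffAt 𝓘(ℝ, F) (𝓘(ℝ, F).prod 𝓘(ℝ, F)) ∞ (fun y ↦ TotalSpace.mk' F y (W y)) q) :
    T F q →ₗ[ℝ] T F q →ₗ[ℝ] T F q :=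
  LinearMap.mk₂ ℝ (fun a b ↦ leviCivita h (fun y ↦ leviCivita h W y (ext b y)) q a
      - leviCivita h W q (leviCivita h (ext b) q a))
    (fun a a' b ↦ by simp only [leviCivita_add_dir]; abel)
    (fun c a b ↦ by simp only [leviCivita_smul_dir, smul_sub])
    -- Linearity in `b` is not formal: `b` enters through its extension, which is additive near `q`,
    -- and ∇_a of the extension is the Christoffel term.
    (fun a b b' ↦ by
      have h1 : leviCivita h (fun y ↦ leviCivita h W y (ext (b + b') y)) q a
          = leviCivita h (fun y ↦ leviCivita h W y (ext b y)) q a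
            + leviCivita h (fun y ↦ leviCivita h W y (ext b' y)) q a := by
        rw [← leviCivita_add h (diffAlong_leviCivita_ext h hW b) (diffAlong_leviCivita_ext h hW b')]
        refine leviCivita_congr h ?_ a
        filter_upwards [eventually_ext_add b b'] with y hy
        rw [hy, leviCivita_add_dir, Pi.add_apply]
      rw [h1, leviCivita_ext, leviCivita_ext, leviCivita_ext, christoffel_add_right,
        leviCivita_add_dir]
      abel)
    (fun c a b ↦ by
      have h1 : leviCivita h (fun y ↦ leviCivita h W y (ext (c • b) y)) q a
          = c • leviCivita h (fun y ↦ leviCivita h W y (ext b y)) q a := by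
        rw [← leviCivita_const_smul h c (diffAlong_leviCivita_ext h hW b)]
        refine leviCivita_congr h ?_ a
        filter_upwards [eventually_ext_smul c b] with y hy
        rw [hy, leviCivita_smul_dir, Pi.smul_apply]
      rw [h1, leviCivita_ext, leviCivita_ext, christoffel_smul_right, leviCivita_smul_dir,
        smul_sub])

theorem hessian_apply (h : Metric F N) {W : (y : N) → T F y} {q : N}
    (hW : ContMDiffAt 𝓘(ℝ, F) (𝓘(ℝ, F).prod 𝓘(ℝ, F)) ∞ (fun y ↦ TotalSpace.mk' F y (W y)) q)
    (a b : T F q) :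
    hessian h hW a b = leviCivita h (fun y ↦ leviCivita h W y (ext b y)) q a
      - leviCivita h W q (leviCivita h (ext b) q a) := rfl

/-- The product rule for `∇W(V)`, where `V` is a section of `φ⁻¹TN`. -/
theorem pullbackCov_leviCivita (h : Metric F N) {φ : M → N} {p : M}
    (hφ : MDifferentiableAt 𝓘(ℝ, E) 𝓘(ℝ, F) φ p) {W : (y : N) → T F y}
    (hW : ContMDiffAt 𝓘(ℝ, F) (𝓘(ℝ, F).prod 𝓘(ℝ, F)) ∞ (fun y ↦ TotalSpace.mk' F y (W y)) (φ p))
    {V : (p : M) → T F (φ p)} (hV : DiffAlong E φ V p) (u : T E p) :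
    pullbackCov h φ (fun p' ↦ leviCivita h W (φ p') (V p')) p u
      = hessian h hW (mfderiv 𝓘(ℝ, E) 𝓘(ℝ, F) φ p u) (V p)
        + leviCivita h W (φ p) (pullbackCov h φ V p u) := by
  obtain ⟨b, c, hc, hbc⟩ := exists_frame_expansion hφ.continuousAt hV
  have hφc := hφ.continuousAt
  have hext (k) : DiffAlong F (id : N → N) (ext (b k)) (φ p) :=
    diffAlong_id_iff.2 (mdifferentiableAt_ext _)
  have hZ (k) := diffAlong_leviCivita_ext h hW (b k)
  have hd (y : N) (z : T F y) : leviCivita h W y z = covDeriv h W y z := rfl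
  -- After expanding `V` in coordinate fields, the terms with derivatives of the coefficients
  -- assemble to ∇W(∇V), and the remaining ones to the Hessian plus its correction.
  have h1 : pullbackCov h φ V p u = ∑ k, (c k p • leviCivita h (ext (b k)) (φ p)
      (mfderiv 𝓘(ℝ, E) 𝓘(ℝ, F) φ p u) + mvfderiv 𝓘(ℝ, E) (c k) p u • b k) := by
    rw [pullbackCov_congr h hbc, pullbackCov_sum h hφc _ fun k ↦ ((hext k).comp hφ).smul hφc (hc k)]
    refine Finset.sum_congr rfl fun k _ ↦ ?_
    rw [pullbackCov_smul h hφc (hc k) ((hext k).comp hφ), pullbackCov_comp h hφ (hext k), ext_self]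
  have h2 : pullbackCov h φ (fun p' ↦ leviCivita h W (φ p') (V p')) p u
      = ∑ k, (c k p • leviCivita h (fun y ↦ leviCivita h W y (ext (b k) y)) (φ p)
          (mfderiv 𝓘(ℝ, E) 𝓘(ℝ, F) φ p u)
        + mvfderiv 𝓘(ℝ, E) (c k) p u • leviCivita h W (φ p) (b k)) := by
    have h3 : ∀ᶠ p' in 𝓝 p, leviCivita h W (φ p') (V p')
        = ∑ k, c k p' • leviCivita h W (φ p') (ext (b k) (φ p')) := by
      filter_upwards [hbc] with p' hp'
      simp only [hp', hd, map_sum, map_smul]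
    rw [pullbackCov_congr h h3, pullbackCov_sum h hφc _ fun k ↦ ((hZ k).comp hφ).smul hφc (hc k)]
    refine Finset.sum_congr rfl fun k _ ↦ ?_
    rw [pullbackCov_smul h hφc (hc k) ((hZ k).comp hφ), pullbackCov_comp h hφ (hZ k), ext_self]
  have h4 : V p = ∑ k, c k p • b k := by simpa only [ext_self] using hbc.self_of_nhds
  rw [h1, h2, h4]
  simp only [map_sum, map_smul, hessian_apply]
  simp only [hd, map_sum, map_add, map_smul, ← Finset.sum_add_distrib]
  refine Finset.sum_congr rfl fun k _ ↦ ?_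
  module

/-- The composition formula for the second covariant derivative of `W ∘ φ`. -/
theorem secondCov_comp (g : Metric E M) (h : Metric F N) {φ : M → N}
    (hφ : ContMDiff 𝓘(ℝ, E) 𝓘(ℝ, F) ∞ φ) {W : (y : N) → T F y}
    (hW : ∀ y, ContMDiffAt 𝓘(ℝ, F) (𝓘(ℝ, F).prod 𝓘(ℝ, F)) ∞ (fun y ↦ TotalSpace.mk' F y (W y)) y)
    (p : M) (u v : T E p) :
    pullbackCov h φ (fun p' ↦ pullbackCov h φ (fun p'' ↦ W (φ p'')) p' (ext v p')) p u
        - pullbackCov h φ (fun p' ↦ W (φ p')) p (leviCivita g (ext v) p u)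
      = hessian h (hW (φ p)) (mfderiv 𝓘(ℝ, E) 𝓘(ℝ, F) φ p u) (mfderiv 𝓘(ℝ, E) 𝓘(ℝ, F) φ p v)
        + covDeriv h W (φ p) (secondFundamentalForm g h φ p u v) := by
  have hφd (p') : MDifferentiableAt 𝓘(ℝ, E) 𝓘(ℝ, F) φ p' := hφ.mdifferentiableAt (by simp)
  have hWd (y) : DiffAlong F (id : N → N) W y :=
    diffAlong_id_iff.2 ((hW y).mdifferentiableAt (by simp))
  have hV : DiffAlong E φ (fun p' ↦ mfderiv 𝓘(ℝ, E) 𝓘(ℝ, F) φ p' (ext v p')) p :=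
    (diffAlong_iff (hφd p)).2
      ((contMDiffAt_mfderiv_apply hφ.contMDiffAt (contMDiffAt_ext v)).mdifferentiableAt (by simp))
  -- The chain rule turns the inner derivative into ∇W applied to dφ(v). The product rule then
  -- leaves ∇W of ∇^φ_u(dφ v) - dφ(∇_u v), the second fundamental form.
  simp only [pullbackCov_comp h (hφd _) (hWd _)]
  rw [pullbackCov_leviCivita h (hφd p) (hW (φ p)) hV u, ext_self]
  have hd (z) : leviCivita h W (φ p) z = covDeriv h W (φ p) z := rfl
  rw [hd, hd, secondFundamentalForm, map_sub]
  abel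

theorem laplacian_comp (g : Metric E M) (h : Metric F N) {φ : M → N}
    (hφ : ContMDiff 𝓘(ℝ, E) 𝓘(ℝ, F) ∞ φ) {W : (y : N) → T F y}
    (hW : ∀ y, ContMDiffAt 𝓘(ℝ, F) (𝓘(ℝ, F).prod 𝓘(ℝ, F)) ∞ (fun y ↦ TotalSpace.mk' F y (W y)) y)
    (p : M) :
    laplacian g h φ (fun p' ↦ W (φ p')) p
      = -(∑ i, hessian h (hW (φ p)) (mfderiv 𝓘(ℝ, E) 𝓘(ℝ, F) φ p (onb g p i))
            (mfderiv 𝓘(ℝ, E) 𝓘(ℝ, F) φ p (onb g p i))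
          + covDeriv h W (φ p) (tension g h φ p)) := by
  simp only [laplacian, tension, traceAt, secondCov_comp g h hφ hW, Finset.sum_add_distrib, map_sum]


/-! ### Bilinearity of the curvature and the bitension formula -/

theorem leviCivita_leviCivita_ext_add (h : Metric F N) (q : N) (u v w w' : T F q) :
    leviCivita h (fun y ↦ leviCivita h (ext (w + w')) y (ext v y)) q u
      = leviCivita h (fun y ↦ leviCivita h (ext w) y (ext v y)) q u
        + leviCivita h (fun y ↦ leviCivita h (ext w') y (ext v y)) q u := by
  rw [← leviCivita_add h (diffAlong_leviCivita_ext h (contMDiffAt_ext w) v)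
    (diffAlong_leviCivita_ext h (contMDiffAt_ext w') v)]
  refine leviCivita_congr h ?_ u
  -- The extension is differentiated at the nearby points too, so additivity is needed on a
  -- neighbourhood of each of them.
  filter_upwards [(eventually_ext_add w w').eventually_nhds,
    eventually_mdifferentiableAt (contMDiffAt_ext w),
    eventually_mdifferentiableAt (contMDiffAt_ext w')] with y hy hw hw'
  rw [Pi.add_apply, ← leviCivita_add h (diffAlong_id_iff.2 hw) (diffAlong_id_iff.2 hw')]
  exact leviCivita_congr h hy _

theorem leviCivita_leviCivita_ext_smul (h : Metric F N) (q : N) (c : ℝ) (u v w : T F q) :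
    leviCivita h (fun y ↦ leviCivita h (ext (c • w)) y (ext v y)) q u
      = c • leviCivita h (fun y ↦ leviCivita h (ext w) y (ext v y)) q u := by
  rw [← leviCivita_const_smul h c (diffAlong_leviCivita_ext h (contMDiffAt_ext w) v)]
  refine leviCivita_congr h ?_ u
  filter_upwards [(eventually_ext_smul c w).eventually_nhds,
    eventually_mdifferentiableAt (contMDiffAt_ext w)] with y hy hw
  rw [Pi.smul_apply, ← leviCivita_const_smul h c (diffAlong_id_iff.2 hw)]
  exact leviCivita_congr h hy _

theorem curvature_eq (h : Metric F N) (q : N) (u v w : T F q) :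
    curvature h q u v w
      = leviCivita h (fun y ↦ leviCivita h (ext w) y (ext v y)) q u
        - leviCivita h (fun y ↦ leviCivita h (ext w) y (ext u y)) q v := by
  have h0 : leviCivita h (ext w) q 0 = 0 := map_zero (covDeriv h (ext w) q)
  rw [curvature, mlieBracket_ext, h0, sub_zero]

/-- The curvature `R(u, v)w` as a bilinear map of `u` and `w`. -/
def curvatureBilin (h : Metric F N) (q : N) (v : T F q) : T F q →ₗ[ℝ] T F q →ₗ[ℝ] T F q :=
  LinearMap.mk₂ ℝ (fun u w ↦ curvature h q u v w)
    (fun u u' w ↦ by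
      have h1 : leviCivita h (fun y ↦ leviCivita h (ext w) y (ext (u + u') y)) q v
          = leviCivita h (fun y ↦ leviCivita h (ext w) y (ext u y)) q v
            + leviCivita h (fun y ↦ leviCivita h (ext w) y (ext u' y)) q v := by
        rw [← leviCivita_add h (diffAlong_leviCivita_ext h (contMDiffAt_ext w) u)
          (diffAlong_leviCivita_ext h (contMDiffAt_ext w) u')]
        refine leviCivita_congr h ?_ v
        filter_upwards [eventually_ext_add u u'] with y hy
        rw [hy, leviCivita_add_dir, Pi.add_apply]
      simp only [curvature_eq]
      rw [h1, leviCivita_add_dir]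
      abel)
    (fun c u w ↦ by
      have h1 : leviCivita h (fun y ↦ leviCivita h (ext w) y (ext (c • u) y)) q v
          = c • leviCivita h (fun y ↦ leviCivita h (ext w) y (ext u y)) q v := by
        rw [← leviCivita_const_smul h c (diffAlong_leviCivita_ext h (contMDiffAt_ext w) u)]
        refine leviCivita_congr h ?_ v
        filter_upwards [eventually_ext_smul c u] with y hy
        rw [hy, leviCivita_smul_dir, Pi.smul_apply]
      simp only [curvature_eq]
      rw [h1, leviCivita_smul_dir, smul_sub])
    (fun u w w' ↦ by
      simp only [curvature_eq, leviCivita_leviCivita_ext_add]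
      abel)
    (fun c u w ↦ by
      simp only [curvature_eq, leviCivita_leviCivita_ext_smul, smul_sub])

theorem curvatureBilin_apply (h : Metric F N) (q : N) (u v w : T F q) :
    curvatureBilin h q v u w = curvature h q u v w := rfl

/-- The bitension field of `φ` when the tension field of `φ` comes from a vector field on `N`. -/
theorem bitension_of_tension_eq_comp (g : Metric E M) (h : Metric F N) {φ : M → N}
    (hφ : ContMDiff 𝓘(ℝ, E) 𝓘(ℝ, F) ∞ φ) {W : (y : N) → T F y}
    (hW : ∀ y, ContMDiffAt 𝓘(ℝ, F) (𝓘(ℝ, F).prod 𝓘(ℝ, F)) ∞ (fun y ↦ TotalSpace.mk' F y (W y)) y)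
    (hτ : ∀ p, tension g h φ p = W (φ p)) (p : M) :
    bitension g h φ p
      = ∑ i, (hessian h (hW (φ p)) - curvatureBilin h (φ p) (W (φ p)))
          (mfderiv 𝓘(ℝ, E) 𝓘(ℝ, F) φ p (onb g p i)) (mfderiv 𝓘(ℝ, E) 𝓘(ℝ, F) φ p (onb g p i))
        + covDeriv h W (φ p) (W (φ p)) := by
  -- The equality is needed as sections, since the Laplacian differentiates the tension; its
  -- pointwise form then turns ∇_τ(φ) W into ∇_W W.
  have h1 : tension g h φ = fun p' ↦ W (φ p') := funext hτ
  rw [bitension, jacobi, h1, laplacian_comp g h hφ hW p, hτ p]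
  simp only [traceAt, LinearMap.sub_apply, curvatureBilin_apply, Finset.sum_sub_distrib]
  abel

/-! ### Changing the target metric -/

/-- The difference of the Levi-Civita connections of two metrics. -/
def christoffelDiff (h h' : Metric F N) (q : N) : T F q →ₗ[ℝ] T F q →ₗ[ℝ] T F q :=
  LinearMap.mk₂ ℝ (fun u v ↦ christoffel h' q u v - christoffel h q u v)
    (fun u u' v ↦ by simp only [christoffel_add_left]; abel)
    (fun c u v ↦ by simp only [christoffel_smul_left, smul_sub])
    (fun u v v' ↦ by simp only [christoffel_add_right]; abel)
    (fun c u v ↦ by simp only [christoffel_smul_right, smul_sub])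

theorem christoffelDiff_apply (h h' : Metric F N) (q : N) (u v : T F q) :
    christoffelDiff h h' q u v = christoffel h' q u v - christoffel h q u v := rfl

/-- Both connections use the same trivialization at `q`, so the derivative terms cancel. -/
theorem leviCivita_sub_eq_christoffelDiff (h h' : Metric F N) (Y : (y : N) → T F y) (q : N)
    (u : T F q) :
    leviCivita h' Y q u - leviCivita h Y q u = christoffelDiff h h' q u (Y q) := by
  rw [leviCivita, leviCivita, pullbackCov_eq, pullbackCov_eq, mfderiv_id, christoffelDiff_apply]
  exact add_sub_add_left_eq_sub _ _ _

/-- Changing the metric on the target changes the tension field by the trace of the difference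
tensor. -/
theorem tension_sub_tension (g : Metric E M) (h h' : Metric F N) (φ : M → N) (p : M) :
    tension g h' φ p - tension g h φ p
      = ∑ i, christoffelDiff h h' (φ p) (mfderiv 𝓘(ℝ, E) 𝓘(ℝ, F) φ p (onb g p i))
          (mfderiv 𝓘(ℝ, E) 𝓘(ℝ, F) φ p (onb g p i)) := by
  simp only [tension, traceAt, ← Finset.sum_sub_distrib]
  refine Finset.sum_congr rfl fun i _ ↦ ?_
  rw [secondFundamentalForm, secondFundamentalForm, pullbackCov_eq, pullbackCov_eq,
    christoffelDiff_apply, ext_self]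
  abel

theorem tension_id (h h' : Metric F N) (q : N) :
    tension h h' (id : N → N) q = ∑ a, christoffelDiff h h' q (onb h q a) (onb h q a) := by
  rw [tension, traceAt]
  refine Finset.sum_congr rfl fun a _ ↦ ?_
  have h1 := leviCivita_sub_eq_christoffelDiff h h' (ext (onb h q a)) q (onb h q a)
  rw [ext_self] at h1
  rw [← h1, secondFundamentalForm]
  simp only [mfderiv_id]
  rfl

/-- The tension field of the identity map `(N, h) → (N, h')`, as a vector field on `N`. -/
def idTension (h h' : Metric F N) (y : N) : T F y := tension h h' (id : N → N) y

/-- `onb` need not vary continuously. The trace is therefore recomputed in a smooth frame, as the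
sum of ∇'_e e - ∇_e e. -/
theorem contMDiffAt_idTension (h h' : Metric F N) (q : N) :
    ContMDiffAt 𝓘(ℝ, F) (𝓘(ℝ, F).prod 𝓘(ℝ, F)) ∞
      (fun y ↦ TotalSpace.mk' F y (idTension h h' y)) q := by
  obtain ⟨e, he, ho⟩ := exists_orthonormal_frame h q
  have hsum := ContMDiffAt.sum_section (s := Finset.univ) fun i _ ↦
    (contMDiffAt_leviCivita h' (he i) (he i)).sub_section (contMDiffAt_leviCivita h (he i) (he i))
  refine hsum.congr_of_eventuallyEq ?_
  filter_upwards [ho] with y hy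
  refine congrArg (TotalSpace.mk' F y) ?_
  rw [idTension, tension_id, sum_eq_sum h (onb_inner h y) hy]
  refine Finset.sum_congr rfl fun i _ ↦ ?_
  exact (leviCivita_sub_eq_christoffelDiff h h' (e i) y (e i y)).symm

/-! ### Riemannian submersions -/

section submersion

variable {g : Metric E M} {h : Metric F N} {pr : M → N}

theorem exists_horizontal_part (g : Metric E M) (pr : M → N) (p : M) (v : T E p) :
    ∃ k : T E p, mfderiv 𝓘(ℝ, E) 𝓘(ℝ, F) pr p k = 0 ∧ IsHorizontal (F := F) g pr p (v - k) := by
  let _ : RiemannianBundle (fun x : M ↦ TangentSpace 𝓘(ℝ, E) x) := ⟨g.toRiemannianMetric⟩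
  have : FiniteDimensional ℝ (TangentSpace 𝓘(ℝ, E) p) :=
    inferInstanceAs (FiniteDimensional ℝ E)
  let K : Submodule ℝ (TangentSpace 𝓘(ℝ, E) p) :=
    LinearMap.ker (mfderiv 𝓘(ℝ, E) 𝓘(ℝ, F) pr p).toLinearMap
  obtain ⟨k, hk, z, hz, hv⟩ := K.exists_add_mem_mem_orthogonal v
  refine ⟨k, hk, fun w hw ↦ ?_⟩
  rw [hv, add_sub_cancel_left, g.symm]
  exact hz w hw

/-- For a Riemannian submersion, every tangent vector of `N` has a horizontal lift. -/
theorem IsRiemannianSubmersion.exists_horizontal_lift (hsub : IsRiemannianSubmersion g h pr)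
    (p : M) (f : T F (pr p)) :
    ∃ ξ : T E p, mfderiv 𝓘(ℝ, E) 𝓘(ℝ, F) pr p ξ = f ∧
      ∀ v, h.inner (pr p) (mfderiv 𝓘(ℝ, E) 𝓘(ℝ, F) pr p v) f = g.inner p v ξ := by
  obtain ⟨w, hw⟩ := hsub.surjective p f
  obtain ⟨k, hk, hhor⟩ := exists_horizontal_part (F := F) g pr p w
  have hξ : mfderiv 𝓘(ℝ, E) 𝓘(ℝ, F) pr p (w - k) = f := by rw [map_sub, hk, sub_zero, hw]
  refine ⟨w - k, hξ, fun v ↦ ?_⟩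
  -- The vertical part of `v` contributes to neither side: dπ kills it, and the lift is horizontal.
  obtain ⟨l, hl, hv⟩ := exists_horizontal_part (F := F) g pr p v
  have h1 := hsub.isometric p (v - l) (w - k) hv hhor
  rw [hξ, map_sub, hl, sub_zero] at h1
  rw [h1, map_sub (g.inner p) v l, sub_apply, g.symm p l, hhor l hl, sub_zero]

/-- Traces of bilinear forms are preserved by Riemannian submersions. -/
theorem IsRiemannianSubmersion.sum_comp (hsub : IsRiemannianSubmersion g h pr) (p : M)
    (B : T F (pr p) →ₗ[ℝ] T F (pr p) →ₗ[ℝ] T F (pr p)) :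
    ∑ i, B (mfderiv 𝓘(ℝ, E) 𝓘(ℝ, F) pr p (onb g p i)) (mfderiv 𝓘(ℝ, E) 𝓘(ℝ, F) pr p (onb g p i))
      = ∑ a, B (onb h (pr p) a) (onb h (pr p) a) := by
  choose ξ hξ hadj using fun a ↦ hsub.exists_horizontal_lift p (onb h (pr p) a)
  exact sum_comp_eq_sum g h (mfderiv 𝓘(ℝ, E) 𝓘(ℝ, F) pr p).toLinearMap (onb_inner g p)
    (onb_inner h (pr p)) (fun v a ↦ hadj a v) hξ B

theorem IsRiemannianSubmersion.tension_eq (hsub : IsRiemannianSubmersion g h pr)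
    (hharm : IsHarmonic g h pr) (h' : Metric F N) (p : M) :
    tension g h' pr p = tension h h' (id : N → N) (pr p) := by
  have h1 := tension_sub_tension g h h' pr p
  rw [hharm.tension_eq_zero, sub_zero, hsub.sum_comp p] at h1
  rw [h1, tension_id]

theorem IsRiemannianSubmersion.bitension_eq (hsub : IsRiemannianSubmersion g h pr)
    (hharm : IsHarmonic g h pr) (h' : Metric F N) (p : M) :
    bitension g h' pr p = bitension h h' (id : N → N) (pr p) := by
  have h1 := bitension_of_tension_eq_comp g h' hsub.smooth (contMDiffAt_idTension h h')
    (hsub.tension_eq hharm h') p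
  have h2 := bitension_of_tension_eq_comp h h' contMDiff_id (contMDiffAt_idTension h h')
    (fun _ ↦ rfl) (pr p)
  simp only [mfderiv_id] at h2
  rw [hsub.sum_comp p] at h1
  exact h1.trans h2.symm

end submersion

end Biharmonic

end

theorem mainTheorem2
    {E : Type*} [NormedAddCommGroup E] [NormedSpace ℝ E] [FiniteDimensional ℝ E]
    {M : Type*} [TopologicalSpace M] [ChartedSpace E M] [IsManifold 𝓘(ℝ, E) ∞ M]
    {F : Type*} [NormedAddCommGroup F] [NormedSpace ℝ F] [FiniteDimensional ℝ F]
    {N : Type*} [TopologicalSpace N] [ChartedSpace F N] [IsManifold 𝓘(ℝ, F) ∞ N]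
    (g : Biharmonic.Metric E M) (h htilde : Biharmonic.Metric F N) (pr : M → N)
    (hsub : Biharmonic.IsRiemannianSubmersion g h pr)
    (hharm : Biharmonic.IsHarmonic g h pr) :
    (∀ p : M, Biharmonic.tension g htilde (id ∘ pr) p
      = Biharmonic.tension h htilde (id : N → N) (pr p)) ∧
    (∀ p : M, Biharmonic.bitension g htilde (id ∘ pr) p
      = Biharmonic.bitension h htilde (id : N → N) (pr p)) :=
  -- `id ∘ pr` is definitionally `pr`; only the target metric has changed.
  ⟨hsub.tension_eq hharm htilde, hsub.bitension_eq hharm htilde⟩
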